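/- Let $(R,\mathfrak m)$ be a commutative Artinian local ring with canonical module $\omega$ (the injective hull of the residue field $R/\mathfrak m$), and let $I$ be an ideal of $R$ with $\mathfrak m^2 I = 0$. For a finitely generated $R$-module $M$ fix a minimal free resolution $\cdots \to R^{b_2(M)} \to R^{b_1(M)} \to R^{b_0(M)} \to M \to 0$; here $b_i(M)$ is the $i$-th Betti number of $M$, and $M_i$ denotes the $i$-th syzygy of $M$ in this resolution ($M_0 = M$). The module $M$ is called $I$-free if $M/IM$ is a free $R/I$-module. Write $b_0(I)$ for the minimal number of generators of $I$. Assume that (i) $b_0(I) > 2$; (ii) $b_2(\omega) \le b_1(\omega)$; (iii) $\omega_1$, $\omega_2$ and $\omega_3$ are $I$-free. Suppose that there are a finitely generated non-free $R$-module $M$ with $\mathfrak m I M = 0$ and an integer $i > 1$ such that $$\operatorname{Tor}_i^R(M,\omega) = \operatorname{Tor}_{i+1}^R(M,\omega) = \operatorname{Tor}_{i+2}^R(M,\omega) = 0$$ and such that $M_t$ is $I$-free for all $t$ with $i \le t \le i+3$. Then $R$ is Gorenstein. -/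

import Mathlib

universe u

open CategoryTheory

/-- The `R`-module `M` is `I`-free if `M / IM` is a free `R / I`-module. -/
def IsIFree {R : Type u} [CommRing R] (I : Ideal R)
    (M : Type u) [AddCommGroup M] [Module R M] : Prop :=
  Module.Free (R ⧸ I) (M ⧸ (I • (⊤ : Submodule R M)))

/-- A minimal free resolution
`⋯ → R ^ b₂ → R ^ b₁ → R ^ b₀ → M → 0` of a module `M` over a local ring `R`, with finite ranks
`bᵢ` (the Betti numbers of `M`); minimality says that all differentials have image in the
maximal ideal times their target. -/
structure MinimalFreeResolution (R : Type u) [CommRing R] [IsLocalRing R]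
    (M : Type u) [AddCommGroup M] [Module R M] where
  /-- The rank of the `i`-th free module, that is, the `i`-th Betti number. -/
  betti : ℕ → ℕ
  /-- The augmentation `R ^ b₀ → M`. -/
  aug : (Fin (betti 0) → R) →ₗ[R] M
  /-- The differentials `R ^ bᵢ₊₁ → R ^ bᵢ`. -/
  d : ∀ i : ℕ, (Fin (betti (i + 1)) → R) →ₗ[R] (Fin (betti i) → R)
  aug_surjective : Function.Surjective aug
  exact_zero : Function.Exact (d 0) aug
  exact_succ : ∀ i : ℕ, Function.Exact (d (i + 1)) (d i)
  minimal : ∀ i : ℕ, LinearMap.range (d i) ≤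
    IsLocalRing.maximalIdeal R • (⊤ : Submodule R (Fin (betti i) → R))

/-- The `i`-th syzygy of `M` in a minimal free resolution: `M` itself for `i = 0`, and the image
of `R ^ bᵢ → R ^ bᵢ₋₁` for `i ≥ 1`. -/
def MinimalFreeResolution.syzygy {R : Type u} [CommRing R] [IsLocalRing R]
    {M : Type u} [AddCommGroup M] [Module R M] (F : MinimalFreeResolution R M) :
    ℕ → ModuleCat.{u} R
  | 0 => ModuleCat.of R M
  | i + 1 => ModuleCat.of R (LinearMap.range (F.d i))

/-- A finite module over a local ring is the target of a minimal free cover. -/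
theorem exists_minimalFreeCover (R : Type u) [CommRing R] [IsLocalRing R]
    (M : Type u) [AddCommGroup M] [Module R M] [Module.Finite R M] :
    ∃ (n : ℕ) (f : (Fin n → R) →ₗ[R] M), Function.Surjective f ∧
      LinearMap.ker f ≤ IsLocalRing.maximalIdeal R • (⊤ : Submodule R (Fin n → R)) := by
  classical
  let k := IsLocalRing.ResidueField R
  let b := Module.finBasis k (TensorProduct R k M)
  have hsurj : Function.Surjective (TensorProduct.mk R k M 1) :=
    TensorProduct.mk_surjective R M k IsLocalRing.residue_surjective
  choose v hv using fun i => hsurj (b i)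
  refine ⟨_, Fintype.linearCombination R v, ?_, ?_⟩
  · rw [← LinearMap.range_eq_top, Fintype.range_linearCombination]
    exact IsLocalRing.span_eq_top_of_tmul_eq_basis v b hv
  · intro x hx
    have h0 : ∑ i, (IsLocalRing.residue R (x i)) • b i = 0 := by
      have h1 := congrArg (TensorProduct.mk R k M 1) (LinearMap.mem_ker.mp hx)
      rw [Fintype.linearCombination_apply, map_sum, map_zero] at h1
      rw [← h1]
      refine Finset.sum_congr rfl fun i _ => ?_
      rw [map_smul, hv]
      exact algebraMap_smul k (x i) (b i)
    have h2 := Fintype.linearIndependent_iff.mp b.linearIndependent _ h0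
    rw [pi_eq_sum_univ' x]
    refine Submodule.sum_mem _ fun i _ => ?_
    exact Submodule.smul_mem_smul ((IsLocalRing.residue_eq_zero_iff _).mp (h2 i)) trivial

/-- Every finite module over a Noetherian local ring has a minimal free resolution. -/
theorem MinimalFreeResolution.nonempty (R : Type u) [CommRing R] [IsLocalRing R]
    [IsNoetherianRing R] (M : Type u) [AddCommGroup M] [Module R M] [Module.Finite R M] :
    Nonempty (MinimalFreeResolution R M) := by
  obtain ⟨n, f, hf, hfm⟩ := exists_minimalFreeCover R M
  choose nx g hg hgm using fun (p : Σ m : ℕ, Submodule R (Fin m → R)) =>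
    exists_minimalFreeCover R p.2
  let st : ℕ → Σ m : ℕ, Submodule R (Fin m → R) := fun i =>
    Nat.rec ⟨n, LinearMap.ker f⟩ (fun _ p => ⟨nx p, LinearMap.ker (g p)⟩) i
  have hmin : ∀ i, (st i).2 ≤
      IsLocalRing.maximalIdeal R • (⊤ : Submodule R (Fin (st i).1 → R)) := by
    intro i
    cases i with
    | zero => exact hfm
    | succ i => exact hgm (st i)
  have hrange : ∀ i, LinearMap.range ((st i).2.subtype ∘ₗ g (st i)) = (st i).2 := by
    intro i
    rw [LinearMap.range_comp_of_range_eq_top _ (LinearMap.range_eq_top.mpr (hg (st i))),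
      Submodule.range_subtype]
  refine ⟨⟨fun i => (st i).1, f, fun i => (st i).2.subtype ∘ₗ g (st i), hf, ?_, ?_, ?_⟩⟩
  · exact LinearMap.exact_iff.mpr (hrange 0).symm
  · intro i
    refine LinearMap.exact_iff.mpr ?_
    rw [hrange (i + 1), LinearMap.ker_comp_of_ker_eq_bot _ (Submodule.ker_subtype _)]
  · intro i
    rw [hrange i]
    exact hmin i

/-- The vanishing of `Tor_i^R(M, N)`. -/
def TorVanishes (R : Type u) [CommRing R] (i : ℕ) (M N : Type u)
    [AddCommGroup M] [Module R M] [AddCommGroup N] [Module R N] : Prop :=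
  Limits.IsZero
    (((Tor (ModuleCat.{u} R) i).obj (ModuleCat.of R M)).obj (ModuleCat.of R N))

/-- `ω` is a canonical (dualizing) module of the Artinian local ring `R`: a finite module which is
an injective hull of the residue field, that is, an injective module which is an essential
extension of (a copy of) the residue field. -/
structure IsCanonicalModule (R : Type u) [CommRing R] [IsLocalRing R]
    (ω : Type u) [AddCommGroup ω] [Module R ω] : Prop where
  finite : Module.Finite R ω
  injective : Module.Injective R ω
  essential : ∃ f : IsLocalRing.ResidueField R →ₗ[R] ω, Function.Injective f ∧
    ∀ N : Submodule R ω, N ⊓ LinearMap.range f = ⊥ → N = ⊥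

/-- A Noetherian local ring is Gorenstein if it has finite injective dimension as a module over
itself. -/
def IsGorensteinLocalRing (R : Type u) [CommRing R] [IsLocalRing R] [IsNoetherianRing R] : Prop :=
  ∃ n : ℕ, HasInjectiveDimensionLE (ModuleCat.of R R) n

/-! Put N = M_i. Dimension shifting turns the vanishing of Tor into Tor_1(N, ω) = Tor_2(N, ω) = 0,
that is, N ⊗ ω_1 and N ⊗ ω_2 embed in the free covers tensored with N
(`lTensor_subtype_injective_of_torVanishes`).

Reduction to I = m. As N is a syzygy, it sits in m times a free module, so mIN = 0. As ω_1 is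
I-free, ω_2 sits in I times a free module (`ker_le_smul_top_of_isIFree`). Hence m kills N ⊗ ω_2. If
ω_2 = 0, then ω is free and R is Gorenstein. Otherwise N and ω_2 are nonzero and I-free, so N ⊗ ω_2
maps onto R/I; thus m ≤ I, so I = m and m³ = 0.

The case m³ = 0 (`isGorensteinLocalRing_of_cube_eq_bot`). Write n = b_0(N), l = length(mN), b_t =
b_t(ω), e = b_0(m). Measuring N ⊗ ω_2 and N ⊗ ω_1 gives b_1 l ≤ n b_2 and n b_1 ≤ b_0 l. With b_2 ≤
b_1 this forces b_1 ≤ b_0, provided b_1 ≠ 0. Counting lengths in 0 → ω_1 → R^{b_0} → ω → 0, and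
using that ω has a simple socle, gives b_0 e ≤ b_1 + e. Since e > 2, it follows that b_0 ≤ 1. So ω
is cyclic, and being faithful it is free; then R is a summand of an injective module. -/

/-! ### Minimal resolutions as projective resolutions, and vanishing of Tor as exactness. -/

namespace MinimalFreeResolution

variable {R : Type u} [CommRing R] [IsLocalRing R] {ω : Type u} [AddCommGroup ω] [Module R ω]

/-- The chain complex underlying a minimal free resolution. -/
noncomputable def complex (G : MinimalFreeResolution R ω) : ChainComplex (ModuleCat.{u} R) ℕ :=
  ChainComplex.of (fun i => ModuleCat.of R (Fin (G.betti i) → R))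
    (fun i => ModuleCat.ofHom (G.d i))
    (fun i => by
      ext1
      exact (G.exact_succ i).linearMap_comp_eq_zero)

theorem complex_d (G : MinimalFreeResolution R ω) (i : ℕ) :
    G.complex.d (i + 1) i = ModuleCat.ofHom (G.d i) :=
  ChainComplex.of_d (fun i => ModuleCat.of R (Fin (G.betti i) → R))
    (fun i => ModuleCat.ofHom (G.d i)) i

theorem complex_exactAt_succ (G : MinimalFreeResolution R ω) (n : ℕ) :
    G.complex.ExactAt (n + 1) := by
  rw [HomologicalComplex.exactAt_iff' _ (n + 1 + 1) (n + 1) n (by simp) (by simp),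
    ShortComplex.ShortExact.moduleCat_exact_iff_function_exact]
  change Function.Exact (G.complex.d (n + 1 + 1) (n + 1)) (G.complex.d (n + 1) n)
  rw [complex_d, complex_d]
  exact G.exact_succ n

/-- The augmentation, as a morphism from the degree zero term of the complex. -/
noncomputable def augHom (G : MinimalFreeResolution R ω) : G.complex.X 0 ⟶ ModuleCat.of R ω :=
  ModuleCat.ofHom G.aug

theorem complex_d_comp_augHom (G : MinimalFreeResolution R ω) :
    G.complex.d 1 0 ≫ G.augHom = 0 := by
  rw [complex_d]
  exact ModuleCat.hom_ext G.exact_zero.linearMap_comp_eq_zero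

theorem exact_and_epi_augHom (G : MinimalFreeResolution R ω) :
    (ShortComplex.mk _ _ G.complex_d_comp_augHom).Exact ∧ Epi G.augHom := by
  refine ⟨?_, (ModuleCat.epi_iff_surjective _).2 G.aug_surjective⟩
  rw [ShortComplex.ShortExact.moduleCat_exact_iff_function_exact]
  change Function.Exact (G.complex.d 1 0) G.aug
  rw [complex_d]
  exact G.exact_zero

/-- A minimal free resolution as a projective resolution in the category of modules. -/
noncomputable def projectiveResolution (G : MinimalFreeResolution R ω) :
    ProjectiveResolution (ModuleCat.of R ω) where
  complex := G.complex
  projective n := (IsProjective.iff_projective (Fin (G.betti n) → R)).mp inferInstance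
  π := (ChainComplex.toSingle₀Equiv _ _).symm ⟨G.augHom, G.complex_d_comp_augHom⟩
  quasiIso := ⟨fun n => by
    cases n
    · rw [ChainComplex.quasiIsoAt₀_iff, ShortComplex.quasiIso_iff_of_zeros']
      · refine (ShortComplex.exact_and_epi_g_iff_of_iso
          (ShortComplex.isoMk (Iso.refl _) (Iso.refl _) (Iso.refl _) ?_ ?_)).2
          G.exact_and_epi_augHom
        · exact (Category.id_comp _).trans (Category.comp_id _).symm
        · exact (Category.id_comp G.augHom).trans
            ((ChainComplex.toSingle₀Equiv_symm_apply_f_zero G.augHom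
              G.complex_d_comp_augHom).symm.trans (Category.comp_id _).symm)
      all_goals rfl
    · rw [quasiIsoAt_iff_exactAt']
      · apply complex_exactAt_succ
      · apply ChainComplex.exactAt_succ_single_obj⟩

/-- If `Tor_{t+1}(M, ω) = 0`, then the resolution of `ω` stays exact at place `t + 1` after
tensoring with `M`. -/
theorem exact_lTensor_of_torVanishes (G : MinimalFreeResolution R ω)
    (M : Type u) [AddCommGroup M] [Module R M] {t : ℕ} (h : TorVanishes R (t + 1) M ω) :
    Function.Exact ((G.d (t + 1)).lTensor M) ((G.d t).lTensor M) := by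
  let T := (MonoidalCategory.tensoringLeft (ModuleCat.{u} R)).obj (ModuleCat.of R M)
  have h1 := h.of_iso (G.projectiveResolution.isoLeftDerivedObj T (t + 1)).symm
  have h2 : ((T.mapHomologicalComplex _).obj G.complex).ExactAt (t + 1) :=
    (HomologicalComplex.exactAt_iff_isZero_homology _ _).2 h1
  rw [HomologicalComplex.exactAt_iff' _ (t + 1 + 1) (t + 1) t (by simp) (by simp),
    ShortComplex.ShortExact.moduleCat_exact_iff_function_exact] at h2
  change Function.Exact (T.map (G.complex.d (t + 1 + 1) (t + 1)))
    (T.map (G.complex.d (t + 1) t)) at h2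
  rw [complex_d, complex_d] at h2
  exact h2

end MinimalFreeResolution

/-! ### Dimension shifting by diagram chase. -/

section TensorExactness

variable {R : Type*} [CommRing R]

theorem LinearMap.lTensor_rTensor_comm {A B X Y : Type*} [AddCommGroup A] [Module R A]
    [AddCommGroup B] [Module R B] [AddCommGroup X] [Module R X] [AddCommGroup Y] [Module R Y]
    (f : X →ₗ[R] Y) (d : A →ₗ[R] B) (x : TensorProduct R X A) :
    d.lTensor Y (f.rTensor A x) = f.rTensor B (d.lTensor X x) := by
  rw [← LinearMap.comp_apply, ← LinearMap.comp_apply, LinearMap.lTensor_comp_rTensor,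
    LinearMap.rTensor_comp_lTensor]

/-- Dimension shifting: if `0 → M' → F → M → 0` is exact with `F` flat and `M ⊗ A` is exact at
`A₂`, then `M' ⊗ A` is exact at `A₁`. -/
theorem exact_lTensor_of_shortExact {M' F M A₃ A₂ A₁ A₀ : Type*}
    [AddCommGroup M'] [Module R M'] [AddCommGroup F] [Module R F] [AddCommGroup M] [Module R M]
    [AddCommGroup A₃] [Module R A₃] [AddCommGroup A₂] [Module R A₂]
    [AddCommGroup A₁] [Module R A₁] [AddCommGroup A₀] [Module R A₀]
    [Module.Flat R F] [Module.Flat R A₁]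
    {ι : M' →ₗ[R] F} {p : F →ₗ[R] M} (hι : Function.Injective ι) (hp : Function.Surjective p)
    (hιp : Function.Exact ι p)
    {d₃ : A₃ →ₗ[R] A₂} {d₂ : A₂ →ₗ[R] A₁} {d₁ : A₁ →ₗ[R] A₀}
    (h₂ : Function.Exact d₃ d₂) (h₁ : Function.Exact d₂ d₁)
    (h : Function.Exact (d₃.lTensor M) (d₂.lTensor M)) :
    Function.Exact (d₂.lTensor M') (d₁.lTensor M') := by
  have hF₁ := Module.Flat.lTensor_exact F h₁
  have hF₂ := Module.Flat.lTensor_exact F h₂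
  have hinj := Module.Flat.rTensor_preserves_injective_linearMap (M := A₁) ι hι
  intro x
  constructor
  · intro hx
    -- Lift the image of x in F ⊗ A₁ to y in F ⊗ A₂. In M ⊗ A₂ it becomes a cycle, hence a boundary;
    -- subtracting a lift of that boundary brings y back into M' ⊗ A₂.
    obtain ⟨y, hy⟩ := (hF₁ (ι.rTensor A₁ x)).1 (by rw [LinearMap.lTensor_rTensor_comm, hx, map_zero])
    obtain ⟨z, hz⟩ := (h (p.rTensor A₂ y)).1 (by
      rw [LinearMap.lTensor_rTensor_comm, hy]
      exact (rTensor_exact A₁ hιp hp).apply_apply_eq_zero x)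
    obtain ⟨z', rfl⟩ := LinearMap.rTensor_surjective A₃ hp z
    obtain ⟨w, hw⟩ := (rTensor_exact A₂ hιp hp (y - d₃.lTensor F z')).1 (by
      rw [map_sub, ← hz, LinearMap.lTensor_rTensor_comm, sub_self])
    refine ⟨w, hinj ?_⟩
    rw [← LinearMap.lTensor_rTensor_comm, hw, map_sub, hy, hF₂.apply_apply_eq_zero, sub_zero]
  · rintro ⟨w, rfl⟩
    rw [← LinearMap.comp_apply, ← LinearMap.lTensor_comp, h₁.linearMap_comp_eq_zero,
      LinearMap.lTensor_zero, LinearMap.zero_apply]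

/-- Right exactness makes N ⊗ range d₁ the cokernel of N ⊗ d₂, so exactness at N ⊗ A₁ leaves no
kernel into N ⊗ A₀. -/
theorem lTensor_range_subtype_injective {N A₂ A₁ A₀ : Type*}
    [AddCommGroup N] [Module R N] [AddCommGroup A₂] [Module R A₂]
    [AddCommGroup A₁] [Module R A₁] [AddCommGroup A₀] [Module R A₀]
    {d₂ : A₂ →ₗ[R] A₁} {d₁ : A₁ →ₗ[R] A₀} (h₁ : Function.Exact d₂ d₁)
    (h : Function.Exact (d₂.lTensor N) (d₁.lTensor N)) :
    Function.Injective ((LinearMap.range d₁).subtype.lTensor N) := by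
  rw [injective_iff_map_eq_zero]
  intro x hx
  obtain ⟨y, rfl⟩ := LinearMap.lTensor_surjective N d₁.surjective_rangeRestrict x
  rw [← LinearMap.comp_apply, ← LinearMap.lTensor_comp] at hx
  obtain ⟨z, rfl⟩ := (h y).1 hx
  have h0 : d₁.rangeRestrict ∘ₗ d₂ = 0 :=
    LinearMap.ext fun a => Subtype.ext (h₁.apply_apply_eq_zero a)
  rw [← LinearMap.comp_apply, ← LinearMap.lTensor_comp, h0, LinearMap.lTensor_zero,
    LinearMap.zero_apply]

end TensorExactness

namespace MinimalFreeResolution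

variable {R : Type u} [CommRing R] [IsLocalRing R]
  {M : Type u} [AddCommGroup M] [Module R M] {ω : Type u} [AddCommGroup ω] [Module R ω]

theorem exact_rangeRestrict (F : MinimalFreeResolution R M) (j : ℕ) :
    Function.Exact (F.d (j + 1)) (F.d j).rangeRestrict := fun x =>
  Subtype.ext_iff.trans (F.exact_succ j x)

theorem exact_subtype_aug (F : MinimalFreeResolution R M) :
    Function.Exact (LinearMap.range (F.d 0)).subtype F.aug :=
  LinearMap.exact_iff.2 (by rw [Submodule.range_subtype, LinearMap.exact_iff.1 F.exact_zero])

theorem exact_subtype_rangeRestrict (F : MinimalFreeResolution R M) (j : ℕ) :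
    Function.Exact (LinearMap.range (F.d (j + 1))).subtype (F.d j).rangeRestrict :=
  LinearMap.exact_iff.2 (by
    rw [Submodule.range_subtype, LinearMap.exact_iff.1 (F.exact_rangeRestrict j)])

/-- Dimension shifting along a minimal free resolution of the first argument of `Tor`. -/
theorem exact_lTensor_syzygy (F : MinimalFreeResolution R M) (G : MinimalFreeResolution R ω)
    (j : ℕ) : ∀ t : ℕ, Function.Exact ((G.d (t + j + 2)).lTensor M) ((G.d (t + j + 1)).lTensor M) →
      Function.Exact ((G.d (t + 1)).lTensor (LinearMap.range (F.d j)))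
        ((G.d t).lTensor (LinearMap.range (F.d j))) := by
  induction j with
  | zero =>
    intro t h
    exact exact_lTensor_of_shortExact (Submodule.subtype_injective _) F.aug_surjective
      F.exact_subtype_aug (G.exact_succ (t + 1)) (G.exact_succ t) h
  | succ j ih =>
    intro t h
    refine exact_lTensor_of_shortExact (Submodule.subtype_injective _)
      (F.d j).surjective_rangeRestrict (F.exact_subtype_rangeRestrict j)
      (G.exact_succ (t + 1)) (G.exact_succ t) (ih (t + 1) ?_)
    rwa [show t + 1 + j = t + (j + 1) by omega]

/-- The ranges of `F.d j` and `G.d t` are the syzygies M_{j+1} and ω_{t+1}. The injectivity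
expresses Tor_1(M_{j+1}, ω_t) = 0, which shifts to degree t + j + 2 for M and ω. -/
theorem lTensor_subtype_injective_of_torVanishes
    (F : MinimalFreeResolution R M) (G : MinimalFreeResolution R ω) {j t : ℕ}
    (h : TorVanishes R (t + j + 2) M ω) :
    Function.Injective
      ((LinearMap.range (G.d t)).subtype.lTensor (LinearMap.range (F.d j))) :=
  lTensor_range_subtype_injective (G.exact_succ t)
    (F.exact_lTensor_syzygy G j t (G.exact_lTensor_of_torVanishes M h))

end MinimalFreeResolution

open IsLocalRing (maximalIdeal ResidueField)

/-! ### Lengths and minimal numbers of generators. -/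

section Length

variable {R : Type*} [CommRing R]

theorem mem_smul_top_pi_iff {ι N : Type*} [Finite ι] [AddCommGroup N] [Module R N] (I : Ideal R)
    (x : ι → N) :
    x ∈ I • (⊤ : Submodule R (ι → N)) ↔ ∀ i, x i ∈ I • (⊤ : Submodule R N) := by
  classical
  cases nonempty_fintype ι
  constructor
  · intro hx i
    exact Submodule.smul_top_le_comap_smul_top I (LinearMap.proj (R := R) (φ := fun _ => N) i) hx
  · intro h
    rw [← Finset.univ_sum_single x]
    exact Submodule.sum_mem _ fun i _ => Submodule.smul_top_le_comap_smul_top I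
      (LinearMap.single R (fun _ => N) i) (h i)

theorem length_smul_top_pi {ι N : Type*} [Fintype ι] [AddCommGroup N] [Module R N] (I : Ideal R) :
    Module.length R (I • (⊤ : Submodule R (ι → N)) : Submodule R (ι → N)) =
      Fintype.card ι * Module.length R (I • (⊤ : Submodule R N) : Submodule R N) := by
  let e : (I • (⊤ : Submodule R (ι → N)) : Submodule R (ι → N)) ≃ₗ[R]
      (ι → (I • (⊤ : Submodule R N) : Submodule R N)) :=
    { toFun := fun x i => ⟨x.1 i, (mem_smul_top_pi_iff I x.1).1 x.2 i⟩
      invFun := fun y => ⟨fun i => y i, (mem_smul_top_pi_iff I _).2 fun i => (y i).2⟩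
      map_add' := fun _ _ => rfl
      map_smul' := fun _ _ => rfl
      left_inv := fun _ => rfl
      right_inv := fun _ => rfl }
  rw [e.length_eq, Module.length_pi_of_fintype]
  simp

theorem LinearEquiv.length_smul_top {X Y : Type*} [AddCommGroup X] [Module R X]
    [AddCommGroup Y] [Module R Y] (e : X ≃ₗ[R] Y) (I : Ideal R) :
    Module.length R (I • (⊤ : Submodule R X) : Submodule R X) =
      Module.length R (I • (⊤ : Submodule R Y) : Submodule R Y) := by
  have h : (I • (⊤ : Submodule R X)).map (e : X →ₗ[R] Y) = I • (⊤ : Submodule R Y) := by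
    rw [Submodule.map_smul'', Submodule.map_top, LinearEquiv.range]
  exact ((e.submoduleMap _).trans (LinearEquiv.ofEq _ _ h)).length_eq

theorem length_smul_top_tensor_pi {ι N : Type*} [Fintype ι] [DecidableEq ι] [AddCommGroup N]
    [Module R N] (I : Ideal R) :
    Module.length R (I • (⊤ : Submodule R (TensorProduct R N (ι → R))) : Submodule R _) =
      Fintype.card ι * Module.length R (I • (⊤ : Submodule R N) : Submodule R N) := by
  rw [LinearEquiv.length_smul_top (TensorProduct.piScalarRight R R N ι), length_smul_top_pi]

variable [IsLocalRing R]

theorem length_residueField : Module.length R (ResidueField R) = 1 := by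
  rw [Module.length_eq_one_iff]
  exact isSimpleModule_iff_isCoatom.2 (IsLocalRing.maximalIdeal.isMaximal R).out

theorem length_pi_residueField (ι : Type*) [Fintype ι] :
    Module.length R (ι → ResidueField R) = Fintype.card ι := by
  rw [Module.length_pi_of_fintype]
  simp [length_residueField]

theorem smul_residueField_eq_zero {c : R} (hc : c ∈ maximalIdeal R) (x : ResidueField R) :
    c • x = 0 := by
  rw [Algebra.smul_def, IsLocalRing.ResidueField.algebraMap_eq,
    (IsLocalRing.residue_eq_zero_iff c).2 hc, zero_mul]

/-- A minimal free cover `R ^ ι → L` induces an isomorphism `L / mL ≃ k ^ ι`. -/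
theorem exists_surjective_pi_residueField {ι L : Type*} [Finite ι] [AddCommGroup L] [Module R L]
    {f : (ι → R) →ₗ[R] L} (hf : Function.Surjective f)
    (hker : LinearMap.ker f ≤ maximalIdeal R • ⊤) :
    ∃ p : L →ₗ[R] (ι → ResidueField R), Function.Surjective p ∧
      LinearMap.ker p = maximalIdeal R • ⊤ := by
  let π : (ι → R) →ₗ[R] (ι → ResidueField R) :=
    (Algebra.linearMap R (ResidueField R)).compLeft ι
  have hπ : Function.Surjective π := fun y => by
    choose x hx using fun i => IsLocalRing.residue_surjective (y i)
    exact ⟨x, funext hx⟩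
  have hπker : LinearMap.ker π = maximalIdeal R • ⊤ := by
    ext x
    rw [mem_smul_top_pi_iff, LinearMap.mem_ker, funext_iff]
    refine forall_congr' fun i => ?_
    rw [smul_eq_mul, Ideal.mul_top]
    exact IsLocalRing.residue_eq_zero_iff (x i)
  let p : L →ₗ[R] (ι → ResidueField R) :=
    (LinearMap.ker f).liftQ π (hker.trans hπker.ge) ∘ₗ
      (f.quotKerEquivOfSurjective hf).symm.toLinearMap
  have hp : ∀ x, p (f x) = π x := fun x => by
    have : (f.quotKerEquivOfSurjective hf).symm (f x) = Submodule.Quotient.mk x := by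
      rw [LinearEquiv.symm_apply_eq]
      rfl
    simp only [p, LinearMap.comp_apply, LinearEquiv.coe_coe, this]
    rfl
  refine ⟨p, fun y => ?_, le_antisymm ?_ ?_⟩
  · obtain ⟨x, rfl⟩ := hπ y
    exact ⟨f x, hp x⟩
  · intro y hy
    obtain ⟨x, rfl⟩ := hf y
    have hx : x ∈ LinearMap.ker π := by rw [LinearMap.mem_ker, ← hp]; exact hy
    rw [hπker] at hx
    exact Submodule.smul_top_le_comap_smul_top _ f hx
  · refine Submodule.smul_le.2 fun c hc y _ => ?_
    rw [LinearMap.mem_ker, map_smul]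
    exact funext fun i => smul_residueField_eq_zero hc _

theorem length_eq_of_minimalCover {ι L : Type*} [Fintype ι] [AddCommGroup L] [Module R L]
    {f : (ι → R) →ₗ[R] L} (hf : Function.Surjective f)
    (hker : LinearMap.ker f ≤ maximalIdeal R • ⊤) :
    Module.length R L =
      Module.length R (maximalIdeal R • ⊤ : Submodule R L) + Fintype.card ι := by
  obtain ⟨p, hp, hpk⟩ := exists_surjective_pi_residueField hf hker
  rw [← length_pi_residueField (R := R) ι]
  exact Module.length_eq_add_of_exact (Submodule.subtype _) p (Submodule.subtype_injective _) hp
    (LinearMap.exact_iff.2 (by rw [Submodule.range_subtype, hpk]))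

/-- A map from R^ι to a module killed by m factors through k^ι, whose length is the cardinality of
ι. -/
theorem length_le_card_of_smul_top_eq_bot {ι X : Type*} [Fintype ι] [AddCommGroup X] [Module R X]
    {g : (ι → R) →ₗ[R] X} (hg : Function.Surjective g)
    (hX : maximalIdeal R • (⊤ : Submodule R X) = ⊥) :
    Module.length R X ≤ Fintype.card ι := by
  obtain ⟨p, hp, hpk⟩ := exists_surjective_pi_residueField (R := R) (ι := ι)
    (f := LinearMap.id) Function.surjective_id (by simp)
  have hle : LinearMap.ker p ≤ LinearMap.ker g := by
    rw [hpk]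
    intro x hx
    have := Submodule.smul_top_le_comap_smul_top _ g hx
    rwa [Submodule.mem_comap, hX] at this
  rw [← length_pi_residueField (R := R) ι, ← (p.quotKerEquivOfSurjective hp).length_eq]
  refine Module.length_le_of_surjective ((LinearMap.ker p).liftQ g hle) fun x => ?_
  obtain ⟨y, rfl⟩ := hg x
  exact ⟨Submodule.Quotient.mk y, rfl⟩

/-- The minimal number of generators of a tensor product is at least the product of the minimal
numbers of generators. -/
theorem card_mul_card_le_length_tensor {ι κ N L : Type*} [Fintype ι] [Fintype κ]
    [AddCommGroup N] [Module R N] [AddCommGroup L] [Module R L]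
    {f : (ι → R) →ₗ[R] N} (hf : Function.Surjective f)
    (hker : LinearMap.ker f ≤ maximalIdeal R • ⊤)
    {g : (κ → R) →ₗ[R] L} (hg : Function.Surjective g)
    (hgker : LinearMap.ker g ≤ maximalIdeal R • ⊤) :
    (Fintype.card ι * Fintype.card κ : ℕ∞) ≤ Module.length R (TensorProduct R N L) := by
  classical
  obtain ⟨p, hp, -⟩ := exists_surjective_pi_residueField hf hker
  obtain ⟨q, hq, -⟩ := exists_surjective_pi_residueField hg hgker
  let μ : TensorProduct R N L →ₗ[R] (ι × κ → ResidueField R) :=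
    LinearMap.pi fun a => LinearMap.mul' R (ResidueField R) ∘ₗ
      TensorProduct.map (LinearMap.proj a.1 ∘ₗ p) (LinearMap.proj a.2 ∘ₗ q)
  have hμ : ∀ x y a, μ (x ⊗ₜ y) a = p x a.1 * q y a.2 := fun _ _ _ => rfl
  have hsurj : Function.Surjective μ := by
    intro z
    -- The coefficient z a is absorbed into the lift x a, so that x a ⊗ y a.2 maps to z a times the
    -- basis vector at a.
    choose x hx using fun a : ι × κ => hp (Pi.single a.1 (z a))
    choose y hy using fun b : κ => hq (Pi.single b 1)
    refine ⟨∑ a, x a ⊗ₜ y a.2, ?_⟩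
    ext b
    rw [map_sum, Finset.sum_apply, Finset.sum_eq_single b]
    · simp [hμ, hx, hy]
    · intro a _ hab
      rw [hμ, hx, hy]
      by_cases h1 : b.1 = a.1
      · have h2 : b.2 ≠ a.2 := fun h2 => hab (Prod.ext h1 h2).symm
        simp [h2]
      · simp [h1]
    · simp
  have := Module.length_le_of_surjective μ hsurj
  rw [length_pi_residueField, Fintype.card_prod] at this
  exact_mod_cast this

theorem length_tensor_le_card_mul_card {ι κ N L : Type*} [Fintype ι] [Fintype κ]
    [AddCommGroup N] [Module R N] [AddCommGroup L] [Module R L]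
    {f : (ι → R) →ₗ[R] N} (hf : Function.Surjective f)
    {g : (κ → R) →ₗ[R] L} (hg : Function.Surjective g)
    (h : maximalIdeal R • (⊤ : Submodule R (TensorProduct R N L)) = ⊥) :
    Module.length R (TensorProduct R N L) ≤ (Fintype.card ι * Fintype.card κ : ℕ∞) := by
  classical
  let e : ((ι × κ) → R) ≃ₗ[R] TensorProduct R (ι → R) (κ → R) :=
    (((Pi.basisFun R ι).tensorProduct (Pi.basisFun R κ)).equivFun).symm
  have := length_le_card_of_smul_top_eq_bot (R := R)
    (g := TensorProduct.map f g ∘ₗ e.toLinearMap)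
    ((TensorProduct.map_surjective hf hg).comp e.surjective) h
  rw [Fintype.card_prod] at this
  exact_mod_cast this

end Length

/-! ### Tensor products and I-free modules. -/

section IFree

variable {R : Type u} [CommRing R]

theorem range_lTensor_le_smul_top {N L F : Type*} [AddCommGroup N] [Module R N]
    [AddCommGroup L] [Module R L] [AddCommGroup F] [Module R F] {J : Ideal R} {ι : L →ₗ[R] F}
    (hι : LinearMap.range ι ≤ J • ⊤) :
    LinearMap.range (ι.lTensor N) ≤ J • (⊤ : Submodule R (TensorProduct R N F)) := by
  rintro _ ⟨x, rfl⟩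
  induction x with
  | zero => rw [map_zero]; exact zero_mem _
  | add x y hx hy => rw [map_add]; exact add_mem hx hy
  | tmul x y =>
    exact Submodule.smul_top_le_comap_smul_top J (TensorProduct.mk R N F x)
      (hι (LinearMap.mem_range_self ι y))

/-- Injectivity places N ⊗ L inside J(N ⊗ F), which K kills because KJ kills N. -/
theorem smul_top_tensor_eq_bot {N L F : Type*} [AddCommGroup N] [Module R N]
    [AddCommGroup L] [Module R L] [AddCommGroup F] [Module R F] {K J : Ideal R} {ι : L →ₗ[R] F}
    (hι : LinearMap.range ι ≤ J • ⊤) (hinj : Function.Injective (ι.lTensor N))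
    (hN : (K * J) • (⊤ : Submodule R N) = ⊥) :
    K • (⊤ : Submodule R (TensorProduct R N L)) = ⊥ := by
  have hzero : ∀ c ∈ K * J, ∀ z : TensorProduct R N F, c • z = 0 := by
    intro c hc z
    induction z with
    | zero => exact smul_zero c
    | add x y hx hy => rw [smul_add, hx, hy, add_zero]
    | tmul x y =>
      have : c • x ∈ (K * J) • (⊤ : Submodule R N) := Submodule.smul_mem_smul hc trivial
      rw [hN, Submodule.mem_bot] at this
      rw [TensorProduct.smul_tmul', this, TensorProduct.zero_tmul]
  rw [eq_bot_iff]
  refine Submodule.smul_le.2 fun c hc x _ => (Submodule.mem_bot R).2 (hinj ?_)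
  rw [map_smul, map_zero]
  refine Submodule.smul_induction_on
    (p := fun z => c • z = 0) (range_lTensor_le_smul_top hι (LinearMap.mem_range_self _ x)) ?_ ?_
  · intro a ha z _
    rw [smul_smul]
    exact hzero _ (Ideal.mul_mem_mul hc ha) z
  · intro y z hy hz
    rw [smul_add, hy, hz, add_zero]

theorem smul_top_submodule_eq_bot {X : Type*} [AddCommGroup X] [Module R X] {N : Submodule R X}
    {J K : Ideal R} (hN : N ≤ K • ⊤) (h : J * K = ⊥) : J • (⊤ : Submodule R N) = ⊥ := by
  rw [eq_bot_iff]
  refine Submodule.smul_le.2 fun c hc x _ => (Submodule.mem_bot R).2 (Subtype.ext ?_)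
  have : c • (x : X) ∈ J • K • (⊤ : Submodule R X) := Submodule.smul_mem_smul hc (hN x.2)
  rw [← Submodule.mul_smul, h, Submodule.bot_smul, Submodule.mem_bot] at this
  exact this

variable [IsLocalRing R]

/-- Lifts to R^ι of an R/I-basis of L/IL generate R^ι by Nakayama. A combination of them lying in
the kernel reduces to a relation among basis vectors, so its coefficients lie in I. -/
theorem ker_le_smul_top_of_isIFree {I : Ideal R} (hI : I ≤ maximalIdeal R)
    {ι : Type*} [Finite ι] {L : Type u} [AddCommGroup L] [Module R L] (hL : IsIFree I L)
    {f : (ι → R) →ₗ[R] L} (hf : Function.Surjective f)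
    (hker : LinearMap.ker f ≤ maximalIdeal R • ⊤) :
    LinearMap.ker f ≤ I • ⊤ := by
  have : Module.Free (R ⧸ I) (L ⧸ (I • (⊤ : Submodule R L))) := hL
  let b := Module.Free.chooseBasis (R ⧸ I) (L ⧸ (I • (⊤ : Submodule R L)))
  let g : (ι → R) →ₗ[R] L ⧸ (I • (⊤ : Submodule R L)) := Submodule.mkQ _ ∘ₗ f
  have hg : Function.Surjective g := (Submodule.mkQ_surjective _).comp hf
  have hgker : LinearMap.ker g ≤ maximalIdeal R • ⊤ := by
    intro x hx
    have h1 : f x ∈ I • (⊤ : Submodule R L) := (Submodule.Quotient.mk_eq_zero _).1 hx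
    rw [← LinearMap.range_eq_top.2 hf, ← Submodule.map_top, ← Submodule.map_smul''] at h1
    obtain ⟨y, hy, hyx⟩ := h1
    have h2 : x - y ∈ LinearMap.ker f := by rw [LinearMap.mem_ker, map_sub, hyx, sub_self]
    have h3 := add_mem (hker h2) (Submodule.smul_mono_left hI hy)
    rwa [sub_add_cancel] at h3
  choose v hv using fun j => hg (b j)
  have hcomb : ∀ r, g (Finsupp.linearCombination R v r) =
      b.repr.symm (r.mapRange (Ideal.Quotient.mk I) (map_zero _)) := by
    intro r
    rw [b.repr_symm_apply, Finsupp.linearCombination_apply, Finsupp.linearCombination_apply,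
      map_finsuppSum, Finsupp.sum_mapRange_index (h := fun i a => a • b i) fun _ => zero_smul _ _]
    refine Finset.sum_congr rfl fun j _ => ?_
    dsimp only
    rw [map_smul, hv]
    rfl
  have hs : LinearMap.range (Finsupp.linearCombination R v) = ⊤ := by
    rw [eq_top_iff]
    refine Submodule.le_of_le_smul_of_le_jacobson_bot (I := maximalIdeal R) Module.Finite.fg_top
      (IsLocalRing.maximalIdeal_le_jacobson _) ?_
    intro x _
    obtain ⟨r, hr⟩ := Finsupp.mapRange_surjective (Ideal.Quotient.mk I) (map_zero _)
      Ideal.Quotient.mk_surjective (b.repr (g x))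
    have h1 : x - Finsupp.linearCombination R v r ∈ LinearMap.ker g := by
      rw [LinearMap.mem_ker, map_sub, hcomb, hr, LinearEquiv.symm_apply_apply, sub_self]
    rw [← add_sub_cancel (Finsupp.linearCombination R v r) x]
    exact Submodule.add_mem_sup (LinearMap.mem_range_self _ r) (hgker h1)
  intro x hx
  obtain ⟨r, rfl⟩ := LinearMap.range_eq_top.1 hs x
  have h1 : g (Finsupp.linearCombination R v r) = 0 := by
    change Submodule.mkQ _ (f _) = 0
    rw [LinearMap.mem_ker.1 hx, map_zero]
  rw [hcomb, LinearEquiv.map_eq_zero_iff] at h1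
  rw [Finsupp.linearCombination_apply]
  refine Submodule.sum_mem _ fun j _ => Submodule.smul_mem_smul ?_ trivial
  exact Ideal.Quotient.eq_zero_iff_mem.1 (DFunLike.congr_fun h1 j)

theorem exists_surjective_quotient_of_isIFree {I : Ideal R} (hI : I ≤ maximalIdeal R)
    {N : Type u} [AddCommGroup N] [Module R N] [Module.Finite R N] [Nontrivial N]
    (hN : IsIFree I N) : ∃ f : N →ₗ[R] R ⧸ I, Function.Surjective f := by
  have : Module.Free (R ⧸ I) (N ⧸ (I • (⊤ : Submodule R N))) := hN
  let b := Module.Free.chooseBasis (R ⧸ I) (N ⧸ (I • (⊤ : Submodule R N)))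
  have hne : Nontrivial (N ⧸ (I • (⊤ : Submodule R N))) := by
    rw [Submodule.Quotient.nontrivial_iff]
    intro h
    exact top_ne_bot (α := Submodule R N) (Submodule.eq_bot_of_le_smul_of_le_jacobson_bot I ⊤
      Module.Finite.fg_top h.ge (hI.trans (IsLocalRing.maximalIdeal_le_jacobson _)))
  obtain ⟨j⟩ := b.index_nonempty
  refine ⟨(b.coord j).restrictScalars R ∘ₗ Submodule.mkQ _,
    Function.Surjective.comp (g := b.coord j) (fun c => ⟨c • b j, ?_⟩)
      (Submodule.mkQ_surjective _)⟩
  rw [map_smul, b.coord_apply, b.repr_self, Finsupp.single_eq_same, smul_eq_mul, mul_one]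

/-- If `N` and `L` are nonzero `I`-free modules, the annihilator of `N ⊗ L` lies in `I`. -/
theorem le_of_smul_top_tensor_eq_bot {I J : Ideal R} (hI : I ≤ maximalIdeal R)
    {N L : Type u} [AddCommGroup N] [Module R N] [Module.Finite R N] [Nontrivial N]
    [AddCommGroup L] [Module R L] [Module.Finite R L] [Nontrivial L]
    (hN : IsIFree I N) (hL : IsIFree I L)
    (h : J • (⊤ : Submodule R (TensorProduct R N L)) = ⊥) : J ≤ I := by
  obtain ⟨f, hf⟩ := exists_surjective_quotient_of_isIFree hI hN
  obtain ⟨g, hg⟩ := exists_surjective_quotient_of_isIFree hI hL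
  obtain ⟨x, hx⟩ := hf 1
  obtain ⟨y, hy⟩ := hg 1
  intro c hc
  have h1 : c • (x ⊗ₜ[R] y) ∈ J • (⊤ : Submodule R (TensorProduct R N L)) :=
    Submodule.smul_mem_smul hc trivial
  rw [h, Submodule.mem_bot] at h1
  have h2 := congrArg (LinearMap.mul' R (R ⧸ I) ∘ₗ TensorProduct.map f g) h1
  rw [map_smul, map_zero, LinearMap.comp_apply, TensorProduct.map_tmul, LinearMap.mul'_apply, hx,
    hy, mul_one, Algebra.smul_def, mul_one] at h2
  exact Ideal.Quotient.eq_zero_iff_mem.1 h2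

end IFree

/-! ### The canonical module: socle, faithfulness, and the Gorenstein criterion. -/

section Gorenstein

theorem Module.Injective.of_leftInverse {R : Type u} [CommRing R] {P Q : Type u} [AddCommGroup P] [Module R P]
    [AddCommGroup Q] [Module R Q] [Module.Injective R Q] (i : P →ₗ[R] Q) (p : Q →ₗ[R] P)
    (h : Function.LeftInverse p i) : Module.Injective R P where
  out X Y _ _ _ _ f hf g := by
    obtain ⟨k, hk⟩ := Module.Injective.out f hf (i ∘ₗ g)
    exact ⟨p ∘ₗ k, fun x => by rw [LinearMap.comp_apply, hk]; exact h (g x)⟩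

variable {R : Type u} [CommRing R] [IsLocalRing R]

theorem IsCanonicalModule.nontrivial {ω : Type u} [AddCommGroup ω] [Module R ω]
    (hω : IsCanonicalModule R ω) : Nontrivial ω := by
  obtain ⟨f, hf, -⟩ := hω.essential
  exact hf.nontrivial

theorem IsCanonicalModule.length_torsionBySet_le_one {ω : Type u} [AddCommGroup ω] [Module R ω]
    (hω : IsCanonicalModule R ω) :
    Module.length R (Submodule.torsionBySet R ω (maximalIdeal R)) ≤ 1 := by
  obtain ⟨f, hf, hess⟩ := hω.essential
  have hle : Submodule.torsionBySet R ω (maximalIdeal R) ≤ LinearMap.range f := by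
    intro x hx
    rw [Submodule.mem_torsionBySet_iff] at hx
    by_cases hx0 : x = 0
    · rw [hx0]; exact zero_mem _
    -- By essentiality some nonzero multiple c x lies in the copy of k; as m kills x, c is a unit.
    have hne : R ∙ x ⊓ LinearMap.range f ≠ ⊥ := fun h =>
      hx0 (Submodule.span_singleton_eq_bot.1 (hess _ h))
    obtain ⟨z, ⟨hz1, hz2⟩, hz0⟩ := Submodule.exists_mem_ne_zero_of_ne_bot hne
    obtain ⟨c, rfl⟩ := Submodule.mem_span_singleton.1 hz1
    have hc : IsUnit c := by
      by_contra hc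
      exact hz0 (hx ⟨c, (IsLocalRing.mem_maximalIdeal c).2 hc⟩)
    exact ((LinearMap.range f).smul_mem_iff_of_isUnit hc).1 hz2
  calc _ ≤ Module.length R (LinearMap.range f) :=
        Module.length_le_of_injective _ (Submodule.inclusion_injective hle)
    _ = 1 := by rw [← (LinearEquiv.ofInjective f hf).length_eq, length_residueField]

/-- If a ≠ 0, then a ↦ 1 defines a map aR → k ⊆ ω, which extends to h : R → ω by injectivity. Then h
a = a h(1) is nonzero, so a does not kill ω. -/
theorem IsCanonicalModule.eq_zero_of_forall_smul_eq_zero {ω : Type u} [AddCommGroup ω] [Module R ω]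
    (hω : IsCanonicalModule R ω) {a : R} (ha : ∀ x : ω, a • x = 0) : a = 0 := by
  by_contra ha0
  obtain ⟨f, hf, -⟩ := hω.essential
  have hker : LinearMap.ker (LinearMap.toSpanSingleton R R a) ≤
      LinearMap.ker (Algebra.linearMap R (ResidueField R)) := by
    intro c hc
    rw [LinearMap.mem_ker, LinearMap.toSpanSingleton_apply] at hc
    refine (IsLocalRing.residue_eq_zero_iff c).2 ((IsLocalRing.mem_maximalIdeal c).2 fun hu => ?_)
    exact ha0 (hu.mul_right_eq_zero.1 hc)
  let e := (LinearMap.toSpanSingleton R R a).quotKerEquivRange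
  let g : LinearMap.range (LinearMap.toSpanSingleton R R a) →ₗ[R] ω :=
    f ∘ₗ (LinearMap.ker (LinearMap.toSpanSingleton R R a)).liftQ _ hker ∘ₗ e.symm.toLinearMap
  have hinj := hω.injective
  obtain ⟨h, hh⟩ := Module.Injective.out (Submodule.subtype _) (Submodule.subtype_injective _) g
  have h1 : g ⟨a, ⟨1, one_smul R a⟩⟩ = f 1 := by
    have : e.symm ⟨a, ⟨1, one_smul R a⟩⟩ = Submodule.Quotient.mk 1 := by
      rw [LinearEquiv.symm_apply_eq]
      exact Subtype.ext (one_smul R a).symm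
    simp only [g, LinearMap.comp_apply, LinearEquiv.coe_coe, this]
    exact congrArg f (map_one (algebraMap R (ResidueField R)))
  have h2 := hh ⟨a, ⟨1, one_smul R a⟩⟩
  rw [h1, Submodule.subtype_apply] at h2
  have h3 : h a = 0 := by
    rw [← ha (h 1), ← map_smul, smul_eq_mul, mul_one]
  exact one_ne_zero (hf ((h2.symm.trans h3).trans (map_zero f).symm))

theorem IsCanonicalModule.isGorensteinLocalRing_of_free [IsNoetherianRing R] {ω : Type u}
    [AddCommGroup ω] [Module R ω] (hω : IsCanonicalModule R ω) (hfree : Module.Free R ω) :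
    IsGorensteinLocalRing R := by
  have := hω.nontrivial
  have := hω.injective
  let b := Module.Free.chooseBasis R ω
  obtain ⟨j⟩ := b.index_nonempty
  have hR : Module.Injective R R :=
    .of_leftInverse (LinearMap.toSpanSingleton R ω (b j)) (b.coord j) fun c => by
      simp
  have : Injective (ModuleCat.of R R) := (Module.injective_iff_injective_object R R).1 hR
  exact ⟨0, inferInstance⟩

end Gorenstein

/-! ### Minimality of the covers; over an Artinian ring a terminating resolution forces freeness. -/

namespace MinimalFreeResolution

variable {R : Type u} [CommRing R] [IsLocalRing R] {M : Type u} [AddCommGroup M] [Module R M]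

theorem ker_rangeRestrict_le (F : MinimalFreeResolution R M) (j : ℕ) :
    LinearMap.ker (F.d j).rangeRestrict ≤ maximalIdeal R • ⊤ := by
  rw [LinearMap.ker_rangeRestrict, LinearMap.exact_iff.1 (F.exact_succ j)]
  exact F.minimal (j + 1)

theorem ker_aug_le (F : MinimalFreeResolution R M) :
    LinearMap.ker F.aug ≤ maximalIdeal R • ⊤ := by
  rw [LinearMap.exact_iff.1 F.exact_zero]
  exact F.minimal 0

end MinimalFreeResolution

/-- Any nonzero element of the last nonzero power of m will do. -/
theorem exists_ne_zero_forall_mul_eq_zero (R : Type*) [CommRing R] [IsLocalRing R]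
    [IsArtinianRing R] : ∃ s : R, s ≠ 0 ∧ ∀ c ∈ maximalIdeal R, s * c = 0 := by
  classical
  have hnil : ∃ n, maximalIdeal R ^ n = ⊥ := by
    have := IsArtinianRing.isNilpotent_jacobson_bot (R := R)
    rwa [IsLocalRing.jacobson_eq_maximalIdeal ⊥ bot_ne_top] at this
  rcases hn : Nat.find hnil with _ | n
  · have := Nat.find_spec hnil
    rw [hn, pow_zero, Ideal.one_eq_top] at this
    exact absurd this top_ne_bot
  · have h1 := Nat.find_min hnil (m := n) (by omega)
    have h2 := Nat.find_spec hnil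
    obtain ⟨s, hs, hs0⟩ := Submodule.exists_mem_ne_zero_of_ne_bot h1
    refine ⟨s, hs0, fun c hc => ?_⟩
    have h3 := Ideal.mul_mem_mul hs hc
    rwa [← pow_succ, ← hn, h2, Ideal.mem_bot] at h3

namespace MinimalFreeResolution

variable {R : Type u} [CommRing R] [IsLocalRing R] {M : Type u} [AddCommGroup M] [Module R M]

/-- Over an Artinian local ring, a module with a vanishing syzygy is free. -/
theorem free_of_range_d_eq_bot [IsArtinianRing R] (F : MinimalFreeResolution R M) (j : ℕ)
    (h : LinearMap.range (F.d j) = ⊥) : Module.Free R M := by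
  induction j with
  | zero =>
    have hinj : Function.Injective F.aug := by
      rw [← LinearMap.ker_eq_bot, LinearMap.exact_iff.1 F.exact_zero, h]
    exact Module.Free.of_equiv (LinearEquiv.ofBijective F.aug ⟨hinj, F.aug_surjective⟩)
  | succ j ih =>
    apply ih
    have hinj : Function.Injective (F.d j) := by
      rw [← LinearMap.ker_eq_bot, LinearMap.exact_iff.1 (F.exact_succ j), h]
    obtain ⟨s, hs0, hs⟩ := exists_ne_zero_forall_mul_eq_zero R
    -- The differential lands in m times its target, where the socle element s acts as zero;
    -- injectivity then makes s kill the free source, which must be 0.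
    have hsx : ∀ x : Fin (F.betti (j + 1)) → R, s • x = 0 := fun x => hinj (by
      rw [map_smul, map_zero]
      refine funext fun a => hs _ ?_
      have := (mem_smul_top_pi_iff _ _).1 (F.minimal j (LinearMap.mem_range_self _ x)) a
      rwa [smul_eq_mul, Ideal.mul_top] at this)
    have hx : ∀ x : Fin (F.betti (j + 1)) → R, x = 0 := by
      intro x
      funext a
      have := congrFun (hsx (Pi.single a 1)) a
      simp [hs0] at this
    rw [eq_bot_iff]
    rintro _ ⟨x, rfl⟩
    rw [hx x, map_zero]
    exact zero_mem _

end MinimalFreeResolution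

/-! ### Length inequalities relating b_0(ω), b_1(ω) and b_0(m). -/

section LengthBounds

variable {R : Type u} [CommRing R]

theorem length_eq_length_ker_inf_add_length_map {X Y : Type*} [AddCommGroup X] [Module R X]
    [AddCommGroup Y] [Module R Y] (f : X →ₗ[R] Y) (S : Submodule R X) :
    Module.length R S = Module.length R (LinearMap.ker f ⊓ S : Submodule R X) +
      Module.length R (S.map f) := by
  refine Module.length_eq_add_of_exact (Submodule.inclusion inf_le_right) (f.submoduleMap S)
    (Submodule.inclusion_injective _) (f.submoduleMap_surjective S) fun x => ?_
  rw [Subtype.ext_iff]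
  constructor
  · intro h
    exact ⟨⟨x, h, x.2⟩, rfl⟩
  · rintro ⟨y, rfl⟩
    exact y.2.1

theorem Submodule.length_mono {X : Type*} [AddCommGroup X] [Module R X] {S T : Submodule R X}
    (h : S ≤ T) : Module.length R S ≤ Module.length R T :=
  Module.length_le_of_injective _ (Submodule.inclusion_injective h)

theorem length_smul_top_submodule {X : Type*} [AddCommGroup X] [Module R X] (J : Ideal R)
    (N : Submodule R X) :
    Module.length R (J • ⊤ : Submodule R N) = Module.length R (J • N : Submodule R X) := by
  have h : (J • (⊤ : Submodule R N)).map N.subtype = J • N := by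
    rw [Submodule.map_smul'', Submodule.map_top, Submodule.range_subtype]
  rw [← h]
  exact (Submodule.equivMapOfInjective _ N.subtype_injective _).length_eq

variable [IsLocalRing R]

/-- Multiply mω by generators y_j of m. The kernel lies in the socle of ω, of length at most 1, and
since m³ = 0 the image lies in a product of copies of the socle indexed by ι. -/
theorem IsCanonicalModule.length_smul_top_le {ω : Type u} [AddCommGroup ω] [Module R ω]
    (hω : IsCanonicalModule R ω) (hm : maximalIdeal R ^ 3 = ⊥) {ι : Type*} [Fintype ι] [Nonempty ι]
    {g : (ι → R) →ₗ[R] maximalIdeal R} (hg : Function.Surjective g) :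
    Module.length R (maximalIdeal R • ⊤ : Submodule R ω) ≤
      Module.length R (maximalIdeal R ^ 2 • ⊤ : Submodule R ω) + Fintype.card ι := by
  classical
  set S := Submodule.torsionBySet R ω (maximalIdeal R)
  set T : Submodule R ω := maximalIdeal R • ⊤
  have hS : Module.length R S ≤ 1 := hω.length_torsionBySet_le_one
  have hcard : (1 : ℕ∞) ≤ Fintype.card ι := by exact_mod_cast Fintype.card_pos
  -- The kernel's length is to be absorbed by that of m²ω, which requires m²ω ≠ 0. If m²ω = 0, then
  -- mω itself lies in the socle.
  by_cases h0 : maximalIdeal R ^ 2 • (⊤ : Submodule R ω) = ⊥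
  · have hTS : T ≤ S := by
      intro x hx
      refine (Submodule.mem_torsionBySet_iff _ _).2 fun c => ?_
      have : (c : R) • x ∈ maximalIdeal R • T := Submodule.smul_mem_smul c.2 hx
      rwa [← Submodule.mul_smul, ← pow_two, h0, Submodule.mem_bot] at this
    exact ((Submodule.length_mono hTS).trans hS).trans (hcard.trans le_add_self)
  let y : ι → R := fun j => g (Pi.single j 1)
  let φ : ω →ₗ[R] (ι → ω) := LinearMap.pi fun j => LinearMap.lsmul R ω (y j)
  have hker : LinearMap.ker φ ≤ S := by
    intro x hx
    refine (Submodule.mem_torsionBySet_iff _ _).2 fun c => ?_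
    obtain ⟨r, hr⟩ := hg c
    have hc : (c : R) = ∑ j, r j * y j := by
      rw [← hr, ← Finset.univ_sum_single r, map_sum, AddSubmonoidClass.coe_finsetSum]
      refine Finset.sum_congr rfl fun j _ => ?_
      have : Pi.single j (r j) = r j • (Pi.single j 1 : ι → R) := by
        rw [← Pi.single_smul, smul_eq_mul, mul_one]
      rw [this, map_smul]
      simp [y]
    rw [hc, Finset.sum_smul]
    refine Finset.sum_eq_zero fun j _ => ?_
    rw [mul_smul]
    have : y j • x = 0 := congrFun hx j
    rw [this, smul_zero]
  have hmap : T.map φ ≤ LinearMap.range (S.subtype.compLeft ι) := by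
    rintro _ ⟨x, hx, rfl⟩
    refine ⟨fun j => ⟨y j • x, (Submodule.mem_torsionBySet_iff _ _).2 fun c => ?_⟩, rfl⟩
    have h1 : ((c : R) * y j) • x ∈ maximalIdeal R ^ 2 • T :=
      Submodule.smul_mem_smul (by
        rw [pow_two]; exact Ideal.mul_mem_mul c.2 (g (Pi.single j 1)).2) hx
    rw [← Submodule.mul_smul, ← pow_succ, hm, Submodule.bot_smul, Submodule.mem_bot] at h1
    rw [smul_smul, h1]
  have h1 : Module.length R (T.map φ) ≤ Fintype.card ι := by
    calc _ ≤ _ := Submodule.length_mono hmap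
      _ ≤ Module.length R (ι → S) := Module.length_le_of_surjective _
          (S.subtype.compLeft ι).surjective_rangeRestrict
      _ = Fintype.card ι * Module.length R S := by rw [Module.length_pi_of_fintype]; simp
      _ ≤ Fintype.card ι * 1 := by gcongr
      _ = _ := mul_one _
  have h2 : 1 ≤ Module.length R (maximalIdeal R ^ 2 • ⊤ : Submodule R ω) := by
    rw [Order.one_le_iff_ne_zero, Ne, Module.length_eq_zero_iff, Submodule.subsingleton_iff_eq_bot]
    exact h0
  rw [length_eq_length_ker_inf_add_length_map φ T]
  exact add_le_add (((Submodule.length_mono (inf_le_left.trans hker)).trans hS).trans h2) h1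

/-- A lower bound for the number of relations of a module. -/
theorem card_mul_card_add_length_le [IsArtinianRing R] {ω : Type u} [AddCommGroup ω] [Module R ω]
    {ι κ ε : Type*} [Fintype ι] [Fintype κ] [Fintype ε]
    {f : (ι → R) →ₗ[R] ω} (hf : Function.Surjective f)
    {g : (κ → R) →ₗ[R] LinearMap.ker f} (hg : Function.Surjective g)
    (hgker : LinearMap.ker g ≤ maximalIdeal R • ⊤) (hker : LinearMap.ker f ≤ maximalIdeal R • ⊤)
    {y : (ε → R) →ₗ[R] maximalIdeal R} (hy : Function.Surjective y)
    (hyker : LinearMap.ker y ≤ maximalIdeal R • ⊤) :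
    Fintype.card ι * Fintype.card ε +
        Module.length R (maximalIdeal R ^ 2 • ⊤ : Submodule R ω) ≤
      Fintype.card κ + Module.length R (maximalIdeal R • ⊤ : Submodule R ω) := by
  have hmap : ∀ J : Ideal R, (J • (⊤ : Submodule R (ι → R))).map f = J • ⊤ := fun J => by
    rw [Submodule.map_smul'', Submodule.map_top, LinearMap.range_eq_top.2 hf]
  have h1 := length_eq_length_ker_inf_add_length_map f (maximalIdeal R • ⊤)
  have h2 := length_eq_length_ker_inf_add_length_map f (maximalIdeal R ^ 2 • ⊤)
  rw [hmap, length_smul_top_pi] at h1 h2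
  have h3 : Module.length R (LinearMap.ker f ⊓ maximalIdeal R • ⊤ : Submodule R _) ≤ _ :=
    Submodule.length_mono inf_le_left
  have h4 : Module.length R (maximalIdeal R • LinearMap.ker f : Submodule R _) ≤
      Module.length R (LinearMap.ker f ⊓ maximalIdeal R ^ 2 • ⊤ : Submodule R _) :=
    Submodule.length_mono (le_inf Submodule.smul_le_right (by
      rw [pow_two, Submodule.mul_smul]
      exact Submodule.smul_mono le_rfl hker))
  have h5 := length_eq_of_minimalCover hg hgker
  have h6 := length_eq_of_minimalCover hy hyker
  rw [length_smul_top_submodule] at h5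
  rw [length_smul_top_submodule, smul_eq_mul, ← pow_two] at h6
  rw [smul_eq_mul, Ideal.mul_top] at h1 h2
  -- Finiteness allows this length to be added to both sides and cancelled afterwards.
  have h7 : Module.length R (LinearMap.ker f ⊓ maximalIdeal R ^ 2 • ⊤ : Submodule R _) ≠ ⊤ :=
    Module.length_ne_top
  rw [← ENat.add_le_add_iff_left h7]
  calc _ = Fintype.card ι * Module.length R (maximalIdeal R) := by
        rw [h6, mul_add, h2]
        abel
    _ ≤ _ := by
        rw [h1]
        refine (add_le_add_left (h3.trans ((h5.trans_le (add_le_add_left h4 _)))) _).trans ?_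
        rw [add_assoc]

end LengthBounds

/-! ### Bounds for the length of N ⊗ L from a free cover or a free embedding. -/

section TensorLength

variable {R : Type u} [CommRing R]

/-- Since J kills N ⊗ L, the submodule J(N ⊗ R^κ) lies in the kernel of N ⊗ f, which is the image of
N ⊗ K. -/
theorem card_mul_length_smul_top_le {κ N K L : Type*} [Fintype κ] [AddCommGroup N] [Module R N]
    [AddCommGroup K] [Module R K] [AddCommGroup L] [Module R L] {J : Ideal R}
    {ι : K →ₗ[R] (κ → R)} {f : (κ → R) →ₗ[R] L} (hf : Function.Surjective f)
    (hιf : Function.Exact ι f) (h : J • (⊤ : Submodule R (TensorProduct R N L)) = ⊥) :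
    Fintype.card κ * Module.length R (J • ⊤ : Submodule R N) ≤
      Module.length R (TensorProduct R N K) := by
  classical
  have hle : J • (⊤ : Submodule R (TensorProduct R N (κ → R))) ≤
      LinearMap.range (ι.lTensor N) := by
    rw [← LinearMap.exact_iff.1 (lTensor_exact N hιf hf)]
    intro x hx
    have := Submodule.smul_top_le_comap_smul_top J (f.lTensor N) hx
    rwa [h] at this
  rw [← length_smul_top_tensor_pi]
  exact (Submodule.length_mono hle).trans
    (Module.length_le_of_surjective _ (ι.lTensor N).surjective_rangeRestrict)

theorem length_tensor_le_card_mul {κ N L : Type*} [Fintype κ] [AddCommGroup N] [Module R N]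
    [AddCommGroup L] [Module R L] {J : Ideal R} {ι : L →ₗ[R] (κ → R)}
    (hι : LinearMap.range ι ≤ J • ⊤) (hinj : Function.Injective (ι.lTensor N)) :
    Module.length R (TensorProduct R N L) ≤
      Fintype.card κ * Module.length R (J • ⊤ : Submodule R N) := by
  classical
  rw [← length_smul_top_tensor_pi, (LinearEquiv.ofInjective _ hinj).length_eq]
  exact Submodule.length_mono (range_lTensor_le_smul_top hι)

end TensorLength

/-! ### The case m³ = 0. -/

section CubeZero

variable {R : Type u} [CommRing R] [IsLocalRing R]

theorem exists_minimalFreeCover_maximalIdeal [IsNoetherianRing R] :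
    ∃ (n : ℕ) (y : (Fin n → R) →ₗ[R] maximalIdeal R), Function.Surjective y ∧
      LinearMap.ker y ≤ maximalIdeal R • ⊤ ∧ Submodule.spanFinrank (maximalIdeal R) ≤ n := by
  obtain ⟨n, y, hy, hyker⟩ := exists_minimalFreeCover R (maximalIdeal R)
  refine ⟨n, y, hy, hyker, ?_⟩
  have hspan : maximalIdeal R =
      Submodule.span R (Set.range fun i => (y (Pi.single i 1) : R)) := by
    have h1 := LinearMap.range_eq_top.2 hy
    rw [← Submodule.map_top, ← (Pi.basisFun R (Fin n)).span_eq, Submodule.map_span,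
      ← Set.range_comp] at h1
    have h2 := congrArg (Submodule.map (maximalIdeal R).subtype) h1
    rw [Submodule.map_span, ← Set.range_comp, Submodule.map_top, Submodule.range_subtype] at h2
    refine h2.symm.trans (congrArg (Submodule.span R ∘ Set.range) (funext fun i => ?_))
    simp
  rw [hspan]
  refine (Submodule.spanFinrank_span_le_ncard_of_finite (Set.finite_range _)).trans ?_
  rw [← Set.image_univ]
  refine (Set.ncard_image_le Set.finite_univ).trans ?_
  rw [Set.ncard_univ, Nat.card_eq_fintype_card, Fintype.card_fin]

theorem IsCanonicalModule.isGorensteinLocalRing_of_surjective [IsNoetherianRing R] {ω : Type u}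
    [AddCommGroup ω] [Module R ω] (hω : IsCanonicalModule R ω) {n : ℕ} (hn : n ≤ 1)
    {f : (Fin n → R) →ₗ[R] ω} (hf : Function.Surjective f) : IsGorensteinLocalRing R := by
  refine hω.isGorensteinLocalRing_of_free
    (Module.Free.of_equiv (LinearEquiv.ofBijective f ⟨?_, hf⟩))
  have : Subsingleton (Fin n) := Fin.subsingleton_iff_le_one.2 hn
  rw [injective_iff_map_eq_zero]
  intro x hx
  ext i
  refine hω.eq_zero_of_forall_smul_eq_zero fun z => ?_
  obtain ⟨c, rfl⟩ := hf z
  -- With at most one coordinate, commutativity of R shows that a relation x kills all of ω, and ω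
  -- is faithful.
  have : x i • c = c i • x := by
    ext k
    rw [Subsingleton.elim k i, Pi.smul_apply, Pi.smul_apply, smul_eq_mul, smul_eq_mul, mul_comm]
  rw [← map_smul, this, map_smul, hx, smul_zero]

/-- The case `m ^ 3 = 0`: here `N` is a nonzero module with `m ^ 2 N = 0` and
`Tor_1(N, ω) = Tor_2(N, ω) = 0`. -/
theorem IsCanonicalModule.isGorensteinLocalRing_of_cube_eq_bot [IsArtinianRing R]
    (hm : maximalIdeal R ^ 3 = ⊥) (hgens : 2 < Submodule.spanFinrank (maximalIdeal R))
    {ω : Type u} [AddCommGroup ω] [Module R ω] (hω : IsCanonicalModule R ω)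
    (G : MinimalFreeResolution R ω) (hbetti : G.betti 2 ≤ G.betti 1)
    {N : Type u} [AddCommGroup N] [Module R N] [Nontrivial N]
    (hN : maximalIdeal R ^ 2 • (⊤ : Submodule R N) = ⊥)
    {n : ℕ} {f : (Fin n → R) →ₗ[R] N} (hf : Function.Surjective f)
    (hker : LinearMap.ker f ≤ maximalIdeal R • ⊤)
    (h1 : Function.Injective ((LinearMap.range (G.d 0)).subtype.lTensor N))
    (h2 : Function.Injective ((LinearMap.range (G.d 1)).subtype.lTensor N)) :
    IsGorensteinLocalRing R := by
  obtain ⟨e, y, hy, hyker, he⟩ := exists_minimalFreeCover_maximalIdeal (R := R)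
  have hfin : Module.Finite R N := Module.Finite.of_surjective f hf
  have hωfin := hω.finite
  have he3 : 3 ≤ e := hgens.trans_le he
  have : Nonempty (Fin e) := ⟨⟨0, by omega⟩⟩
  have hn : 0 < n := by
    rcases Nat.eq_zero_or_pos n with rfl | h
    · exact absurd hf.subsingleton (not_subsingleton N)
    · exact h
  have hrange : ∀ j, LinearMap.range (LinearMap.range (G.d j)).subtype ≤ maximalIdeal R • ⊤ :=
    fun j => by rw [Submodule.range_subtype]; exact G.minimal j
  have hN' : (maximalIdeal R * maximalIdeal R) • (⊤ : Submodule R N) = ⊥ := by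
    rw [← pow_two, hN]
  have hT1 := smul_top_tensor_eq_bot (hrange 0) h1 hN'
  have hT2 := smul_top_tensor_eq_bot (hrange 1) h2 hN'
  have hA := (card_mul_length_smul_top_le (G.d 0).surjective_rangeRestrict
    (G.exact_subtype_rangeRestrict 0) hT1).trans
    (length_tensor_le_card_mul_card hf (G.d 1).surjective_rangeRestrict hT2)
  have hB := (card_mul_card_le_length_tensor hf hker (G.d 0).surjective_rangeRestrict
    (G.ker_rangeRestrict_le 0)).trans (length_tensor_le_card_mul (hrange 0) h1)
  have hC1 := hω.length_smul_top_le hm hy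
  have hkeraug := LinearMap.exact_iff.1 G.exact_zero
  let g : (Fin (G.betti 1) → R) →ₗ[R] LinearMap.ker G.aug :=
    (LinearEquiv.ofEq _ _ hkeraug.symm).toLinearMap ∘ₗ (G.d 0).rangeRestrict
  have hC2 := card_mul_card_add_length_le G.aug_surjective (g := g)
    ((LinearEquiv.ofEq _ _ hkeraug.symm).surjective.comp (G.d 0).surjective_rangeRestrict)
    (by rw [LinearEquiv.ker_comp]; exact G.ker_rangeRestrict_le 0) G.ker_aug_le hy hyker
  have hC : (G.betti 0 * e : ℕ∞) ≤ G.betti 1 + e := by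
    have hfin : Module.length R (maximalIdeal R ^ 2 • ⊤ : Submodule R ω) ≠ ⊤ :=
      Module.length_ne_top
    rw [← ENat.add_le_add_iff_right hfin]
    simp only [Fintype.card_fin] at hC1 hC2
    refine hC2.trans ((add_le_add_right hC1 _).trans_eq ?_)
    abel
  obtain ⟨l, hl⟩ := ENat.ne_top_iff_exists.1
    (Module.length_ne_top : Module.length R (maximalIdeal R • ⊤ : Submodule R N) ≠ ⊤)
  simp only [← hl, Fintype.card_fin] at hA hB
  norm_cast at hA hB hC
  -- The inequality b_1 ≤ b_0 comes from cancelling n b_1, so b_1 = 0 is treated apart; there b_0 e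
  -- ≤ e suffices.
  by_cases ha : G.betti 1 = 0
  · refine hω.isGorensteinLocalRing_of_surjective ?_ G.aug_surjective
    rw [ha, zero_add] at hC
    exact Nat.le_of_mul_le_mul_right (hC.trans_eq (one_mul e).symm) (by omega)
  · have hle : G.betti 1 ≤ G.betti 0 := by
      have h3 : n * G.betti 1 * G.betti 1 ≤ n * G.betti 1 * G.betti 0 := by
        calc n * G.betti 1 * G.betti 1 ≤ G.betti 0 * l * G.betti 1 := by gcongr
          _ = G.betti 0 * (G.betti 1 * l) := by ring
          _ ≤ G.betti 0 * (n * G.betti 2) := by gcongr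
          _ ≤ G.betti 0 * (n * G.betti 1) := by gcongr
          _ = _ := by ring
      exact Nat.le_of_mul_le_mul_left h3 (by positivity)
    refine hω.isGorensteinLocalRing_of_surjective ?_ G.aug_surjective
    by_contra hr
    -- Here b_0 e ≤ b_0 + e means (b_0 - 1)(e - 1) ≤ 1, which is impossible for b_0 ≥ 2 and e ≥ 3.
    nlinarith

end CubeZero

/-! ### Reduction to I = m and conclusion. -/

theorem mainTheorem4 {R : Type u} [CommRing R] [IsLocalRing R] [IsArtinianRing R]
    (I : Ideal R) (hI : IsLocalRing.maximalIdeal R ^ 2 * I = ⊥)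
    (h_gens : 2 < Submodule.spanFinrank I)
    (ω : Type u) [AddCommGroup ω] [Module R ω] (hω : IsCanonicalModule R ω)
    (G : MinimalFreeResolution R ω) (h_betti : G.betti 2 ≤ G.betti 1)
    (M : Type u) [AddCommGroup M] [Module R M] [Module.Finite R M]
    (hM_free : ¬ Module.Free R M)
    (hM : (IsLocalRing.maximalIdeal R * I) • (⊤ : Submodule R M) = ⊥)
    (F : MinimalFreeResolution R M)
    (i : ℕ) (hi : 1 < i)
    (h_tor : ∀ t : ℕ, i ≤ t → t ≤ i + 2 → TorVanishes R t M ω)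
    (hM_syz : ∀ t : ℕ, i ≤ t → t ≤ i + 3 → IsIFree I (F.syzygy t))
    (hω_syz : ∀ t : ℕ, 1 ≤ t → t ≤ 3 → IsIFree I (G.syzygy t)) :
    IsGorensteinLocalRing R := by
  obtain ⟨j, rfl⟩ : ∃ j, i = j + 1 := ⟨i - 1, by omega⟩
  by_cases hω2 : LinearMap.range (G.d 1) = ⊥
  · exact hω.isGorensteinLocalRing_of_free (G.free_of_range_d_eq_bot 1 hω2)
  have hω2' : Nontrivial (LinearMap.range (G.d 1)) :=
    (Submodule.nontrivial_iff_ne_bot).2 hω2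
  have hNnt : Nontrivial (LinearMap.range (F.d j)) :=
    (Submodule.nontrivial_iff_ne_bot).2 fun h => hM_free (F.free_of_range_d_eq_bot j h)
  -- The unit ideal is generated by one element, against the bound on the generators of I.
  have hIne : I ≠ ⊤ := by
    rintro rfl
    have := Submodule.spanFinrank_span_le_ncard_of_finite (R := R) (Set.finite_singleton (1 : R))
    rw [Set.ncard_singleton, ← Ideal.span, Ideal.span_singleton_one] at this
    omega
  have hIm : I ≤ maximalIdeal R := IsLocalRing.le_maximalIdeal hIne
  -- With i = j + 1 and N = M_i, the choices t = 0, 1 use Tor in degrees i + 1 and i + 2, that is,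
  -- Tor_1(N, ω) and Tor_2(N, ω).
  have h1 := F.lTensor_subtype_injective_of_torVanishes G (j := j) (t := 0)
    (h_tor _ (by omega) (by omega))
  have h2 := F.lTensor_subtype_injective_of_torVanishes G (j := j) (t := 1)
    (h_tor _ (by omega) (by omega))
  have hNI : (maximalIdeal R * I) • (⊤ : Submodule R (LinearMap.range (F.d j))) = ⊥ :=
    smul_top_submodule_eq_bot (F.minimal j) (by rw [← hI]; ring)
  have hω1 : LinearMap.range (LinearMap.range (G.d 1)).subtype ≤ I • ⊤ := by
    have := ker_le_smul_top_of_isIFree hIm (hω_syz 1 le_rfl (by omega))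
      (f := (G.d 0).rangeRestrict) (G.d 0).surjective_rangeRestrict (G.ker_rangeRestrict_le 0)
    rwa [Submodule.range_subtype, ← LinearMap.exact_iff.1 (G.exact_rangeRestrict 0)]
  have hNfree : IsIFree I (LinearMap.range (F.d j)) := hM_syz (j + 1) le_rfl (by omega)
  have hω2free : IsIFree I (LinearMap.range (G.d 1)) := hω_syz 2 (by omega) (by omega)
  -- N ⊗ ω_2 embeds in I(N ⊗ R^{b_1}), so m kills it, while it maps onto R/I.
  have hmI : maximalIdeal R ≤ I :=
    le_of_smul_top_tensor_eq_bot hIm hNfree hω2free (smul_top_tensor_eq_bot hω1 h2 hNI)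
  obtain rfl : I = maximalIdeal R := le_antisymm hIm hmI
  exact hω.isGorensteinLocalRing_of_cube_eq_bot (by rw [pow_succ, hI]) h_gens G h_betti
    (by rw [pow_two, hNI]) (F.d j).surjective_rangeRestrict (F.ker_rangeRestrict_le j) h1 h2
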